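/- An ultragraph $\mathcal G=(G^0,\mathcal G^1,r,s)$ consists of sets $G^0$ (vertices) and $\mathcal G^1$ (edges), a map $s:\mathcal G^1\to G^0$ and a map $r:\mathcal G^1\to P(G^0)\setminus\{\emptyset\}$. Let $\mathcal G^0$ be the smallest subset of $P(G^0)$ that contains $\emptyset$, all $\{v\}$ ($v\in G^0$) and all $r(e)$ ($e\in\mathcal G^1$), and is closed under finite unions and intersections of its members. For a commutative unital ring $R$, the Leavitt path algebra $L_R(\mathcal G)$ is the universal (not necessarily unital) associative $R$-algebra with generators $s_e,s_e^*$ ($e\in\mathcal G^1$), $p_A$ ($A\in\mathcal G^0$) and relations (1) $p_\emptyset=0$, $p_Ap_B=p_{A\cap B}$, $p_{A\cup B}=p_A+p_B-p_{A\cap B}$; (2) $p_{s(e)}s_e=s_ep_{r(e)}=s_e$ and $p_{r(e)}s_e^*=s_e^*p_{s(e)}=s_e^*$; (3) $s_e^*s_f=\delta_{e,f}\,p_{r(e)}$; (4) $p_v=\sum_{s(e)=v}s_es_e^*$ whenever $0<|s^{-1}(v)|<\infty$, where $p_v=p_{\{v\}}$. A $\mathcal G$-branching system on a set $X$ consists of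 subsets $R_e$ ($e\in\mathcal G^1$) and $D_A$ ($A\in\mathcal G^0$) of $X$ and bijections $f_e:D_{r(e)}\to R_e$ such that $R_e\cap R_f=\emptyset$ for $e\neq f$; $D_\emptyset=\emptyset$, $D_A\cap D_B=D_{A\cap B}$ and $D_A\cup D_B=D_{A\cup B}$; $R_e\subseteq D_{s(e)}$; and $D_v=\bigcup_{e\in s^{-1}(v)}R_e$ whenever $0<|s^{-1}(v)|<\infty$, where $D_v=D_{\{v\}}$. Its induced representation is the unique $R$-algebra homomorphism $\pi$ from $L_R(\mathcal G)$ to the algebra of $R$-linear endomorphisms of the module of all maps $X\to R$ with $$\pi(s_e)\phi=(\phi\circ f_e^{-1})\cdot 1_{R_e},\qquad \pi(s_e^*)\phi=(\phi\circ f_e)\cdot 1_{D_{r(e)}},\qquad \pi(p_A)\phi=1_{D_A}\cdot\phi$$ (functions cut off by an indicator are extended by zero). **Proposition.** Let $\mathcal G$ be an ultragraph such that $s^{-1}(v)$ and $r(e)$ are finite or countable for each vertex $v$ and each edge $e$. Then there exists a $\mathcal G$-branching system such that, for every commutative unital ring $R$, the induced representation of $L_R(\mathcal G)$ is faithful (injective).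 -/

import Mathlib

universe u v w

/-- An ultragraph with vertex set `V` and edge set `E`: each edge has a source vertex and a
nonempty set of vertices as its range. -/
structure Ultragraph (V : Type u) (E : Type v) where
  s : E → V
  r : E → Set V
  r_nonempty : ∀ e, (r e).Nonempty

namespace Ultragraph

variable {V : Type u} {E : Type v}

/-- Membership in the family of generalized vertices: the smallest family of sets of vertices which
contains `∅`, all `{v}` and all `r e`, and is closed under finite unions and intersections. -/
inductive IsGenVertex (G : Ultragraph V E) : Set V → Prop
  | empty : IsGenVertex G ∅
  | singleton (v : V) : IsGenVertex G {v}
  | range (e : E) : IsGenVertex G (G.r e)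
  | union {A B : Set V} : IsGenVertex G A → IsGenVertex G B → IsGenVertex G (A ∪ B)
  | inter {A B : Set V} : IsGenVertex G A → IsGenVertex G B → IsGenVertex G (A ∩ B)

/-- The type of generalized vertices. -/
def GenVertex (G : Ultragraph V E) : Type u := {A : Set V // G.IsGenVertex A}

namespace GenVertex

variable {G : Ultragraph V E}

instance : EmptyCollection G.GenVertex := ⟨⟨∅, .empty⟩⟩
instance : Union G.GenVertex := ⟨fun A B => ⟨A.1 ∪ B.1, .union A.2 B.2⟩⟩
instance : Inter G.GenVertex := ⟨fun A B => ⟨A.1 ∩ B.1, .inter A.2 B.2⟩⟩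

end GenVertex

/-- The generalized vertex `{v}`. -/
def vert (G : Ultragraph V E) (v : V) : G.GenVertex := ⟨{v}, .singleton v⟩

/-- The generalized vertex `r(e)`. -/
def rng (G : Ultragraph V E) (e : E) : G.GenVertex := ⟨G.r e, .range e⟩

/-- The edges with source `v`. -/
def out (G : Ultragraph V E) (v : V) : Set E := {e | G.s e = v}

/-! ### The ultragraph Leavitt path algebra -/

/-- The symbols `s_e`, `s_e^*` and `p_A`. -/
inductive Gen (G : Ultragraph V E) : Type (max u v)
  | edge (e : E) : Gen G
  | ghost (e : E) : Gen G
  | proj (A : G.GenVertex) : Gen G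

/-- The free associative (not necessarily unital) `R`-algebra on the symbols. -/
abbrev FreeAlg (R : Type w) [CommRing R] (G : Ultragraph V E) : Type (max u v w) :=
  MonoidAlgebra R (FreeSemigroup G.Gen)

namespace FreeAlg

variable (R : Type w) [CommRing R] {G : Ultragraph V E}

/-- A symbol as an element of the free algebra. -/
noncomputable def gen (x : G.Gen) : FreeAlg R G := MonoidAlgebra.single (FreeSemigroup.of x) 1

noncomputable def s (e : E) : FreeAlg R G := gen R (.edge e)
noncomputable def sStar (e : E) : FreeAlg R G := gen R (.ghost e)
noncomputable def p (A : G.GenVertex) : FreeAlg R G := gen R (.proj A)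

end FreeAlg

/-- The defining relations of the ultragraph Leavitt path algebra. -/
inductive Rel (R : Type w) [CommRing R] (G : Ultragraph V E) : FreeAlg R G → FreeAlg R G → Prop
  | p_empty : Rel R G (FreeAlg.p R ∅) 0
  | p_mul (A B : G.GenVertex) : Rel R G (FreeAlg.p R A * FreeAlg.p R B) (FreeAlg.p R (A ∩ B))
  | p_union (A B : G.GenVertex) : Rel R G (FreeAlg.p R (A ∪ B)) (FreeAlg.p R A + FreeAlg.p R B - FreeAlg.p R (A ∩ B))
  | p_mul_s (e : E) : Rel R G (FreeAlg.p R (G.vert (G.s e)) * FreeAlg.s R e) (FreeAlg.s R e)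
  | s_mul_p (e : E) : Rel R G (FreeAlg.s R e * FreeAlg.p R (G.rng e)) (FreeAlg.s R e)
  | p_mul_sStar (e : E) : Rel R G (FreeAlg.p R (G.rng e) * FreeAlg.sStar R e) (FreeAlg.sStar R e)
  | sStar_mul_p (e : E) : Rel R G (FreeAlg.sStar R e * FreeAlg.p R (G.vert (G.s e))) (FreeAlg.sStar R e)
  | sStar_mul_s_self (e : E) : Rel R G (FreeAlg.sStar R e * FreeAlg.s R e) (FreeAlg.p R (G.rng e))
  | sStar_mul_s_of_ne (e f : E) (h : e ≠ f) : Rel R G (FreeAlg.sStar R e * FreeAlg.s R f) 0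
  | p_vert (v : V) (hfin : (G.out v).Finite) (hne : (G.out v).Nonempty) :
      Rel R G (FreeAlg.p R (G.vert v)) (∑ e ∈ hfin.toFinset, FreeAlg.s R e * FreeAlg.sStar R e)

/-- The smallest congruence of `R`-algebras on the free algebra containing the relations. (The ideal
of a non-unital algebra generated by a set closed under scalars is closed under scalars.) -/
noncomputable def leavittCon (R : Type w) [CommRing R] (G : Ultragraph V E) : RingCon (FreeAlg R G) :=
  ringConGen fun a b => ∃ (c : R) (x y : FreeAlg R G), Rel R G x y ∧ a = c • x ∧ b = c • y

theorem leavittCon_smul {R : Type w} [CommRing R] {G : Ultragraph V E} (c : R)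
    {a b : FreeAlg R G} (h : leavittCon R G a b) : leavittCon R G (c • a) (c • b) := by
  change RingConGen.Rel _ a b at h
  change RingConGen.Rel _ (c • a) (c • b)
  induction h generalizing c with
  | of x y h =>
    obtain ⟨d, x', y', h, rfl, rfl⟩ := h
    exact .of _ _ ⟨c * d, x', y', h, by rw [mul_smul], by rw [mul_smul]⟩
  | refl x => exact .refl _
  | symm _ ih => exact (ih c).symm
  | trans _ _ ih₁ ih₂ => exact (ih₁ c).trans (ih₂ c)
  | add _ _ ih₁ ih₂ => rw [smul_add, smul_add]; exact (ih₁ c).add (ih₂ c)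
  | mul _ h₂ ih₁ _ => rw [← smul_mul_assoc, ← smul_mul_assoc]; exact (ih₁ c).mul h₂

/-- The Leavitt path algebra of an ultragraph: the universal `R`-algebra (not necessarily unital)
on the symbols `s_e`, `s_e^*`, `p_A` subject to the defining relations. -/
noncomputable def LeavittPathAlgebra (R : Type w) [CommRing R] (G : Ultragraph V E) : Type (max u v w) :=
  (leavittCon R G).Quotient

namespace LeavittPathAlgebra

section

variable (R : Type w) [CommRing R] (G : Ultragraph V E)

noncomputable instance : NonUnitalRing (LeavittPathAlgebra R G) :=
  inferInstanceAs (NonUnitalRing (leavittCon R G).Quotient)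

/-- The class of an element of the free algebra. -/
noncomputable def mk (x : FreeAlg R G) : LeavittPathAlgebra R G := (x : (leavittCon R G).Quotient)

variable {R G}

theorem mk_surjective : Function.Surjective (mk R G) := Quotient.mk_surjective

theorem mk_add (x y : FreeAlg R G) : mk R G (x + y) = mk R G x + mk R G y := rfl

theorem mk_mul (x y : FreeAlg R G) : mk R G (x * y) = mk R G x * mk R G y := rfl

theorem mk_zero : mk R G 0 = 0 := rfl

noncomputable instance : SMul R (LeavittPathAlgebra R G) :=
  ⟨fun c => Quotient.map (fun x : FreeAlg R G => c • x) fun _ _ h => leavittCon_smul c h⟩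

theorem mk_smul (c : R) (x : FreeAlg R G) : mk R G (c • x) = c • mk R G x := rfl

noncomputable instance : Module R (LeavittPathAlgebra R G) where
  one_smul := mk_surjective.forall.2 fun x => by rw [← mk_smul, one_smul]
  mul_smul a b := mk_surjective.forall.2 fun x => by simp only [← mk_smul, mul_smul]
  smul_zero a := by rw [← mk_zero, ← mk_smul, smul_zero]
  smul_add a := mk_surjective.forall₂.2 fun x y => by simp only [← mk_smul, ← mk_add, smul_add]
  add_smul a b := mk_surjective.forall.2 fun x => by simp only [← mk_smul, ← mk_add, add_smul]
  zero_smul := mk_surjective.forall.2 fun x => by rw [← mk_smul, zero_smul, mk_zero]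

instance : IsScalarTower R (LeavittPathAlgebra R G) (LeavittPathAlgebra R G) where
  smul_assoc a := mk_surjective.forall₂.2 fun x y => by
    simp only [smul_eq_mul, ← mk_smul, ← mk_mul, smul_mul_assoc]

instance : SMulCommClass R (LeavittPathAlgebra R G) (LeavittPathAlgebra R G) where
  smul_comm a := mk_surjective.forall₂.2 fun x y => by
    simp only [smul_eq_mul, ← mk_smul, ← mk_mul, mul_smul_comm]

variable (R)

/-- The generators of the algebra. -/
noncomputable def s (e : E) : LeavittPathAlgebra R G := mk R G (FreeAlg.s R e)
noncomputable def sStar (e : E) : LeavittPathAlgebra R G := mk R G (FreeAlg.sStar R e)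
noncomputable def p (A : G.GenVertex) : LeavittPathAlgebra R G := mk R G (FreeAlg.p R A)

variable {R}

theorem mk_eq_mk_of_rel {x y : FreeAlg R G} (h : Rel R G x y) : mk R G x = mk R G y :=
  Quotient.sound (RingConGen.Rel.of _ _ ⟨1, x, y, h, (one_smul R x).symm, (one_smul R y).symm⟩)

end

section lift

variable {R : Type w} [CommRing R] {G : Ultragraph V E}
  {A : Type*} [NonUnitalRing A] [Module R A] [IsScalarTower R A A] [SMulCommClass R A A]

/-- The homomorphism from the free algebra with given values on the symbols. -/
noncomputable def freeLift (φ : G.Gen → A) : FreeAlg R G →ₙₐ[R] A :=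
  MonoidAlgebra.liftMagma R (FreeSemigroup.lift φ)

theorem freeLift_gen (φ : G.Gen → A) (x : G.Gen) : freeLift (R := R) φ (FreeAlg.gen R x) = φ x := by
  simp [freeLift, FreeAlg.gen]

/-- The homomorphism given by the universal property: an assignment to the symbols that respects
the defining relations extends to the Leavitt path algebra. -/
noncomputable def lift (φ : G.Gen → A)
    (h : ∀ x y, Rel R G x y → freeLift (R := R) φ x = freeLift (R := R) φ y) :
    LeavittPathAlgebra R G →ₙₐ[R] A :=
  have key : ∀ x y, leavittCon R G x y → freeLift (R := R) φ x = freeLift (R := R) φ y := by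
    intro x y hxy
    change RingConGen.Rel _ x y at hxy
    induction hxy with
    | of x y hr => obtain ⟨c, x, y, hr, rfl, rfl⟩ := hr; rw [map_smul, map_smul, h x y hr]
    | refl x => rfl
    | symm _ ih => exact ih.symm
    | trans _ _ ih₁ ih₂ => exact ih₁.trans ih₂
    | add _ _ ih₁ ih₂ => rw [map_add, map_add, ih₁, ih₂]
    | mul _ _ ih₁ ih₂ => rw [map_mul, map_mul, ih₁, ih₂]
  { toFun := fun x => Quotient.liftOn x (freeLift (R := R) φ) key
    map_smul' := fun c => mk_surjective.forall.2 fun x => map_smul (freeLift (R := R) φ) c x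
    map_zero' := map_zero (freeLift (R := R) φ)
    map_add' := mk_surjective.forall₂.2 fun x y => map_add (freeLift (R := R) φ) x y
    map_mul' := mk_surjective.forall₂.2 fun x y => map_mul (freeLift (R := R) φ) x y }

theorem lift_mk (φ : G.Gen → A) (h) (x : FreeAlg R G) :
    lift φ h (mk R G x) = freeLift (R := R) φ x := rfl

/-- A homomorphism on the Leavitt path algebra is determined by its values on the generators. -/
theorem hom_ext {φ ψ : LeavittPathAlgebra R G →ₙₐ[R] A} (hs : ∀ e, φ (s R e) = ψ (s R e))
    (ht : ∀ e, φ (sStar R e) = ψ (sStar R e)) (hp : ∀ B, φ (p R B) = ψ (p R B)) : φ = ψ := by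
  let q : FreeAlg R G →ₙₐ[R] LeavittPathAlgebra R G :=
    { toFun := mk R G, map_smul' := mk_smul, map_zero' := mk_zero, map_add' := mk_add,
      map_mul' := mk_mul }
  have : φ.comp q = ψ.comp q := by
    apply (MonoidAlgebra.liftMagma R).symm.injective
    apply FreeSemigroup.lift.symm.injective
    funext x
    cases x with
    | edge e => exact hs e
    | ghost e => exact ht e
    | proj B => exact hp B
  ext x
  obtain ⟨x, rfl⟩ := mk_surjective x
  exact DFunLike.congr_fun this x

end lift

end LeavittPathAlgebra

/-! ### Branching systems and the induced representations -/

/-- A `G`-algebraic branching system on the set `X`. -/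
structure BranchingSystem (G : Ultragraph V E) (X : Type*) where
  R : E → Set X
  D : G.GenVertex → Set X
  R_disjoint : ∀ e f, e ≠ f → R e ∩ R f = ∅
  D_empty : D ∅ = ∅
  D_inter : ∀ A B, D A ∩ D B = D (A ∩ B)
  D_union : ∀ A B, D A ∪ D B = D (A ∪ B)
  R_subset : ∀ e, R e ⊆ D (G.vert (G.s e))
  D_vert : ∀ v, (G.out v).Finite → (G.out v).Nonempty → D (G.vert v) = ⋃ e ∈ G.out v, R e
  /-- The bijection `f_e : D_{r(e)} → R_e`, together with its inverse. -/
  f : ∀ e, D (G.rng e) ≃ R e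

namespace BranchingSystem

variable {G : Ultragraph V E} {X : Type*} (B : G.BranchingSystem X) (K : Type w) [CommRing K]

open Classical in
/-- `S_e φ = (φ ∘ f_e⁻¹) · 1_{R_e}`. -/
noncomputable def opS (e : E) : Module.End K (X → K) where
  toFun φ x := if h : x ∈ B.R e then φ ((B.f e).symm ⟨x, h⟩) else 0
  map_add' φ ψ := by funext x; by_cases h : x ∈ B.R e <;> simp [h]
  map_smul' c φ := by funext x; by_cases h : x ∈ B.R e <;> simp [h]

open Classical in
/-- `S_e^* φ = (φ ∘ f_e) · 1_{D_{r(e)}}`. -/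
noncomputable def opSStar (e : E) : Module.End K (X → K) where
  toFun φ x := if h : x ∈ B.D (G.rng e) then φ (B.f e ⟨x, h⟩) else 0
  map_add' φ ψ := by funext x; by_cases h : x ∈ B.D (G.rng e) <;> simp [h]
  map_smul' c φ := by funext x; by_cases h : x ∈ B.D (G.rng e) <;> simp [h]

open Classical in
/-- `P_A φ = 1_{D_A} · φ`. -/
noncomputable def opP (A : G.GenVertex) : Module.End K (X → K) where
  toFun φ x := if x ∈ B.D A then φ x else 0
  map_add' φ ψ := by funext x; by_cases h : x ∈ B.D A <;> simp [h]
  map_smul' c φ := by funext x; by_cases h : x ∈ B.D A <;> simp [h]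

/-- The operators assigned to the symbols. -/
noncomputable def op : G.Gen → Module.End K (X → K)
  | .edge e => B.opS K e
  | .ghost e => B.opSStar K e
  | .proj A => B.opP K A

theorem op_respects (x y : FreeAlg K G) (h : Rel K G x y) :
    LeavittPathAlgebra.freeLift (R := K) (B.op K) x =
      LeavittPathAlgebra.freeLift (R := K) (B.op K) y := by
  classical
  have hD : ∀ (A C : G.GenVertex) x, x ∈ B.D (A ∩ C) ↔ x ∈ B.D A ∧ x ∈ B.D C := fun A C x => by
    rw [← B.D_inter]; rfl
  have hU : ∀ (A C : G.GenVertex) x, x ∈ B.D (A ∪ C) ↔ x ∈ B.D A ∨ x ∈ B.D C := fun A C x => by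
    rw [← B.D_union]; rfl
  have hne : ∀ e f x, e ≠ f → x ∈ B.R e → x ∉ B.R f := fun e f x hef he hf => by
    have : x ∈ B.R e ∩ B.R f := ⟨he, hf⟩
    rw [B.R_disjoint e f hef] at this; exact this
  have hS : ∀ e x, x ∈ B.R e → x ∈ B.D (G.vert (G.s e)) := fun e x hx => B.R_subset e hx
  have h1 : ∀ (e : E) (φ : X → K) (x : X),
      B.opS K e (B.opSStar K e φ) x = if x ∈ B.R e then φ x else 0 := fun e φ x => by
    by_cases hx : x ∈ B.R e <;> simp [opS, opSStar, hx]
  cases h with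
  | p_empty =>
    simp only [FreeAlg.p, LeavittPathAlgebra.freeLift_gen, map_zero, op]
    ext φ x
    simp [opP, B.D_empty]
  | p_mul A C =>
    simp only [FreeAlg.p, map_mul, LeavittPathAlgebra.freeLift_gen, op]
    ext1 φ; funext x
    by_cases hA : x ∈ B.D A <;> by_cases hC : x ∈ B.D C <;> simp [opP, hD, hA, hC]
  | p_union A C =>
    simp only [FreeAlg.p, map_add, map_sub, LeavittPathAlgebra.freeLift_gen, op]
    ext1 φ; funext x
    by_cases hA : x ∈ B.D A <;> by_cases hC : x ∈ B.D C <;> simp [opP, hD, hU, hA, hC]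
  | p_mul_s e =>
    simp only [FreeAlg.p, FreeAlg.s, map_mul, LeavittPathAlgebra.freeLift_gen, op]
    ext1 φ; funext x
    by_cases hx : x ∈ B.R e
    · simp [opP, opS, hx, hS e x hx]
    · simp [opP, opS, hx]
  | s_mul_p e =>
    simp only [FreeAlg.p, FreeAlg.s, map_mul, LeavittPathAlgebra.freeLift_gen, op]
    ext1 φ; funext x
    by_cases hx : x ∈ B.R e <;> simp [opP, opS, hx]
  | p_mul_sStar e =>
    simp only [FreeAlg.p, FreeAlg.sStar, map_mul, LeavittPathAlgebra.freeLift_gen, op]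
    ext1 φ; funext x
    by_cases hx : x ∈ B.D (G.rng e) <;> simp [opP, opSStar, hx]
  | sStar_mul_p e =>
    simp only [FreeAlg.p, FreeAlg.sStar, map_mul, LeavittPathAlgebra.freeLift_gen, op]
    ext1 φ; funext x
    by_cases hx : x ∈ B.D (G.rng e)
    · simp [opP, opSStar, hx, hS e _ (B.f e ⟨x, hx⟩).2]
    · simp [opSStar, hx]
  | sStar_mul_s_self e =>
    simp only [FreeAlg.p, FreeAlg.s, FreeAlg.sStar, map_mul, LeavittPathAlgebra.freeLift_gen, op]
    ext1 φ; funext x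
    by_cases hx : x ∈ B.D (G.rng e) <;> simp [opP, opS, opSStar, hx]
  | sStar_mul_s_of_ne e f hef =>
    simp only [FreeAlg.s, FreeAlg.sStar, map_mul, map_zero, LeavittPathAlgebra.freeLift_gen, op]
    ext1 φ; funext x
    by_cases hx : x ∈ B.D (G.rng e)
    · simp [opS, opSStar, hx, hne e f _ hef (B.f e ⟨x, hx⟩).2]
    · simp [opSStar, hx]
  | p_vert v hfin hv =>
    simp only [FreeAlg.p, FreeAlg.s, FreeAlg.sStar, map_mul, map_sum,
      LeavittPathAlgebra.freeLift_gen, op]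
    ext1 φ; funext x
    rw [LinearMap.sum_apply, Finset.sum_apply]
    simp only [Module.End.mul_apply, h1]
    by_cases hx : x ∈ B.D (G.vert v)
    · have hx' := hx
      rw [B.D_vert v hfin hv] at hx'
      obtain ⟨e, he, hxe⟩ := Set.mem_iUnion₂.1 hx'
      rw [Finset.sum_eq_single e]
      · simp [opP, hx, hxe]
      · intro f _ hfe
        rw [if_neg (hne e f x hfe.symm hxe)]
      · intro h; exact absurd (hfin.mem_toFinset.2 he) h
    · rw [Finset.sum_eq_zero]
      · simp [opP, hx]
      · intro e he
        refine if_neg fun hxe => hx ?_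
        have hs : G.s e = v := hfin.mem_toFinset.1 he
        exact hs ▸ hS e x hxe

/-- The representation of the Leavitt path algebra on the module of all maps `X → K` induced by a
branching system on `X`. -/
noncomputable def inducedRep : LeavittPathAlgebra K G →ₙₐ[K] Module.End K (X → K) :=
  LeavittPathAlgebra.lift (B.op K) (B.op_respects K)

theorem inducedRep_s (e : E) : B.inducedRep K (LeavittPathAlgebra.s K e) = B.opS K e :=
  LeavittPathAlgebra.freeLift_gen _ _

theorem inducedRep_sStar (e : E) :
    B.inducedRep K (LeavittPathAlgebra.sStar K e) = B.opSStar K e :=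
  LeavittPathAlgebra.freeLift_gen _ _

theorem inducedRep_p (A : G.GenVertex) :
    B.inducedRep K (LeavittPathAlgebra.p K A) = B.opP K A :=
  LeavittPathAlgebra.freeLift_gen _ _

end BranchingSystem

end Ultragraph

namespace Ultragraph

/-! Let the space be `V × ℕ × FreeGroup E`, with `D_A` the points over `A` and `R_e` the points over
`s(e)` whose integer lies in a set `part e`. For each vertex that emits edges, these sets partition
`ℕ` into infinite pieces, so countability of `r(e)` gives a bijection of `r(e) × ℕ` with `part e`.
Letting `f_e` also multiply the last coordinate by `e` makes the representation graded by the free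
group: `s_e` has degree `e`, `s_e^*` degree `e⁻¹` and `p_A` degree `1`.

Faithfulness then follows from a graded uniqueness theorem (`IsCompatibleGrading.injective`): a
homomorphism compatible with such a grading is injective once it kills no nonzero multiple of any
`p_v`. Let `D` be the span of the elements `s_α p_A s_α^*`. The algebra is the sum of the blocks
`s_μ D s_ν^*` over pairs of words without a common last letter (`mem_blockSum`). For such pairs
`μν⁻¹` is a reduced word, so distinct blocks have distinct degrees (`wordDegree_injective`), and an
element of the kernel has all its block components in the kernel. Cancelling `s_μ` and `s_ν^*`
reduces each block to `D`, where induction on the length of `α` applies (`faithfulOn_diag`). The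
induction rests on the fact that the `p_A` satisfy every linear relation between the indicators
`1_A` (`combP_eq_zero`). -/

theorem GenVertex.ext {V : Type u} {E : Type v} {G : Ultragraph V E} {A B : G.GenVertex}
    (h : ∀ v, v ∈ A.1 ↔ v ∈ B.1) : A = B :=
  Subtype.ext (Set.ext h)

namespace LeavittPathAlgebra

/-! ### The defining relations inside the quotient. -/

section Relations

variable {V : Type u} {E : Type v} (R : Type w) [CommRing R] (G : Ultragraph V E)

/-- The quotient map from the free algebra, as a homomorphism. -/
noncomputable def mkHom : FreeAlg R G →ₙₐ[R] LeavittPathAlgebra R G where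
  toFun := mk R G
  map_smul' := mk_smul
  map_zero' := mk_zero
  map_add' := mk_add
  map_mul' := mk_mul

variable {G}

theorem mkHom_eq_of_rel {x y : FreeAlg R G} (h : Rel R G x y) : mkHom R G x = mkHom R G y :=
  mk_eq_mk_of_rel h

theorem mkHom_s (e : E) : mkHom R G (FreeAlg.s R e) = s R e := rfl

theorem mkHom_sStar (e : E) : mkHom R G (FreeAlg.sStar R e) = sStar R e := rfl

theorem mkHom_p (A : G.GenVertex) : mkHom R G (FreeAlg.p R A) = p R A := rfl

theorem p_empty : p R (∅ : G.GenVertex) = 0 := by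
  simpa [mkHom_p] using mkHom_eq_of_rel R (Rel.p_empty (R := R) (G := G))

theorem p_mul_p (A B : G.GenVertex) : p R A * p R B = p R (A ∩ B) := by
  simpa [mkHom_p] using mkHom_eq_of_rel R (Rel.p_mul (R := R) A B)

theorem p_union (A B : G.GenVertex) : p R (A ∪ B) = p R A + p R B - p R (A ∩ B) := by
  simpa [mkHom_p] using mkHom_eq_of_rel R (Rel.p_union (R := R) A B)

theorem p_source_mul_s (e : E) : p R (G.vert (G.s e)) * s R e = s R e := by
  simpa [mkHom_p, mkHom_s] using mkHom_eq_of_rel R (Rel.p_mul_s (R := R) (G := G) e)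

theorem s_mul_p_rng (e : E) : s R e * p R (G.rng e) = s R e := by
  simpa [mkHom_p, mkHom_s] using mkHom_eq_of_rel R (Rel.s_mul_p (R := R) (G := G) e)

theorem p_rng_mul_sStar (e : E) : p R (G.rng e) * sStar R e = sStar R e := by
  simpa [mkHom_p, mkHom_sStar] using mkHom_eq_of_rel R (Rel.p_mul_sStar (R := R) (G := G) e)

theorem sStar_mul_p_source (e : E) : sStar R e * p R (G.vert (G.s e)) = sStar R e := by
  simpa [mkHom_p, mkHom_sStar] using mkHom_eq_of_rel R (Rel.sStar_mul_p (R := R) (G := G) e)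

theorem sStar_mul_s_self (e : E) : sStar R e * s R e = p R (G.rng e) := by
  simpa [mkHom_p, mkHom_s, mkHom_sStar] using
    mkHom_eq_of_rel R (Rel.sStar_mul_s_self (R := R) (G := G) e)

theorem sStar_mul_s_of_ne {e f : E} (h : e ≠ f) :
    sStar R e * s R f = (0 : LeavittPathAlgebra R G) := by
  simpa [mkHom_s, mkHom_sStar] using
    mkHom_eq_of_rel R (Rel.sStar_mul_s_of_ne (R := R) (G := G) e f h)

theorem p_vert_eq_sum (v : V) (hfin : (G.out v).Finite) (hne : (G.out v).Nonempty) :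
    p R (G.vert v) = ∑ e ∈ hfin.toFinset, s R e * sStar R e := by
  simpa [mkHom_p, mkHom_s, mkHom_sStar] using
    mkHom_eq_of_rel R (Rel.p_vert (R := R) (G := G) v hfin hne)

open Classical in
-- A singleton is an atom: its intersection with `A` is either itself or empty.
theorem p_inter_vert (A : G.GenVertex) (v : V) :
    p R (A ∩ G.vert v) = if v ∈ A.1 then p R (G.vert v) else 0 := by
  split_ifs with h
  · congr 1
    refine GenVertex.ext fun x => ⟨fun hx => hx.2, fun hx => ⟨?_, hx⟩⟩
    rw [show x = v from hx]
    exact h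
  · rw [← p_empty R]
    congr 1
    refine GenVertex.ext fun x => ⟨fun hx => h ?_, fun hx => hx.elim⟩
    rw [← show x = v from hx.2]
    exact hx.1

theorem p_mul_p_comm (A B : G.GenVertex) : p R A * p R B = p R B * p R A := by
  rw [p_mul_p, p_mul_p]
  exact congrArg _ (GenVertex.ext fun x => and_comm)

open Classical in
theorem p_mul_s (A : G.GenVertex) (e : E) :
    p R A * s R e = if G.s e ∈ A.1 then s R e else 0 := by
  rw [← p_source_mul_s, ← mul_assoc, p_mul_p, p_inter_vert]
  split_ifs
  · rfl
  · rw [zero_mul]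

open Classical in
theorem sStar_mul_p (A : G.GenVertex) (e : E) :
    sStar R e * p R A = if G.s e ∈ A.1 then sStar R e else 0 := by
  rw [← sStar_mul_p_source, mul_assoc, p_mul_p_comm, p_mul_p, p_inter_vert]
  split_ifs
  · rfl
  · rw [mul_zero]

end Relations

/-! ### Linear relations between the projections. -/

section Projections

variable {V : Type u} {E : Type v} {G : Ultragraph V E} {R : Type w} [CommRing R]

open Classical in
/-- The value at `v` of the function `∑ A, c A • 1_A`. -/
noncomputable def valueAt (c : G.GenVertex →₀ R) (v : V) : R :=
  ∑ A ∈ c.support, if v ∈ A.1 then c A else 0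

/-- The element `∑ A, c A • p_A`. -/
noncomputable def combP (c : G.GenVertex →₀ R) : LeavittPathAlgebra R G :=
  ∑ A ∈ c.support, c A • p R A

open Classical in
-- `B \ C` need not be a generalized vertex, so `p_B - p_{B ∩ C}` stands in for its projection. Each
-- new set `A₀` cuts `B \ C` into `(B ∩ A₀) \ C`, where its coefficient is absorbed into the
-- constant `k`, and `B \ (C ∪ A₀)`, where it contributes nothing. Once no sets remain, either the
-- region is empty or one of its points forces `k = 0`.
theorem localized_sum_smul_p_eq_zero (T : Finset G.GenVertex) (c : G.GenVertex → R) :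
    ∀ (B C : G.GenVertex) (k : R),
      (∀ v ∈ B.1, v ∉ C.1 → k + ∑ A ∈ T, (if v ∈ A.1 then c A else 0) = 0) →
      k • (p R B - p R (B ∩ C)) + ∑ A ∈ T, c A • ((p R B - p R (B ∩ C)) * p R A) = 0 := by
  induction T using Finset.induction_on with
  | empty =>
    intro B C k h
    simp only [Finset.sum_empty, add_zero] at h ⊢
    by_cases hBC : B.1 ⊆ C.1
    · rw [show B ∩ C = B from GenVertex.ext fun x => ⟨fun hx => hx.1, fun hx => ⟨hx, hBC hx⟩⟩,
        sub_self, smul_zero]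
    · obtain ⟨v, hv, hv'⟩ := Set.not_subset.1 hBC
      rw [h v hv hv', zero_smul]
  | insert A₀ T hA ih =>
    intro B C k h
    have h₁ := ih (B ∩ A₀) C (k + c A₀) fun v hv hC => by
      have := h v hv.1 hC
      rwa [Finset.sum_insert hA, if_pos hv.2, ← add_assoc] at this
    have h₂ := ih B (C ∪ A₀) k fun v hv hC => by
      have := h v hv fun h => hC (Or.inl h)
      rwa [Finset.sum_insert hA, if_neg fun h => hC (Or.inr h), zero_add] at this
    have e₁ : p R (B ∩ (C ∪ A₀)) = p R (B ∩ C) + p R (B ∩ A₀) - p R (B ∩ A₀ ∩ C) := by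
      rw [show B ∩ (C ∪ A₀) = (B ∩ C) ∪ (B ∩ A₀) from
        GenVertex.ext fun x => and_or_left, p_union]
      congr 2
      refine GenVertex.ext fun x => ?_
      change (x ∈ B.1 ∧ x ∈ C.1) ∧ (x ∈ B.1 ∧ x ∈ A₀.1) ↔ (x ∈ B.1 ∧ x ∈ A₀.1) ∧ x ∈ C.1
      tauto
    have e₂ : (p R B - p R (B ∩ C)) * p R A₀ = p R (B ∩ A₀) - p R (B ∩ A₀ ∩ C) := by
      rw [sub_mul, p_mul_p, p_mul_p]
      congr 2
      refine GenVertex.ext fun x => ?_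
      change (x ∈ B.1 ∧ x ∈ C.1) ∧ x ∈ A₀.1 ↔ (x ∈ B.1 ∧ x ∈ A₀.1) ∧ x ∈ C.1
      tauto
    rw [Finset.sum_insert hA, e₂]
    rw [e₁] at h₂
    rw [← add_zero (0 : LeavittPathAlgebra R G)]
    nth_rewrite 1 [← h₁]
    rw [← h₂]
    have e₃ : ∑ A ∈ T, c A • ((p R B - p R (B ∩ C)) * p R A) =
        ∑ A ∈ T, c A • ((p R (B ∩ A₀) - p R (B ∩ A₀ ∩ C)) * p R A) +
        ∑ A ∈ T, c A • ((p R B - (p R (B ∩ C) + p R (B ∩ A₀) - p R (B ∩ A₀ ∩ C))) * p R A) := by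
      rw [← Finset.sum_add_distrib]
      refine Finset.sum_congr rfl fun A _ => ?_
      rw [← smul_add, ← add_mul]
      congr 2
      abel
    rw [e₃]
    module

theorem exists_forall_subset (T : Finset G.GenVertex) : ∃ B : G.GenVertex, ∀ A ∈ T, A.1 ⊆ B.1 := by
  classical
  induction T using Finset.induction_on with
  | empty => exact ⟨∅, by simp⟩
  | insert A T _ ih =>
    obtain ⟨B, hB⟩ := ih
    refine ⟨A ∪ B, fun C hC => ?_⟩
    rcases Finset.mem_insert.1 hC with rfl | hC
    · exact Set.subset_union_left
    · exact (hB C hC).trans Set.subset_union_right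

/-- The projections `p_A` satisfy every linear relation that holds between the indicator
functions `1_A`. -/
theorem combP_eq_zero {c : G.GenVertex →₀ R} (h : ∀ v, valueAt c v = 0) : combP c = 0 := by
  classical
  obtain ⟨B, hB⟩ := exists_forall_subset c.support
  -- With `C = ∅` and `k = 0` the localizing factor is `p_B`, a left unit for every `p_A` in the sum
  -- because `B` contains each `A`.
  have := localized_sum_smul_p_eq_zero c.support c B ∅ 0 fun v _ _ => by
    rw [zero_add]; exact h v
  rw [zero_smul, zero_add] at this
  rw [← this, combP]
  refine Finset.sum_congr rfl fun A hA => ?_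
  rw [show B ∩ ∅ = ∅ from GenVertex.ext fun x => ⟨fun hx => hx.2, fun hx => hx.elim⟩, p_empty,
    sub_zero, p_mul_p, show B ∩ A = A from
      GenVertex.ext fun x => ⟨fun hx => hx.2, fun hx => ⟨hB A hA hx, hx⟩⟩]

theorem valueAt_eq_sum (c : G.GenVertex →₀ R) (v : V) [DecidablePred fun A : G.GenVertex => v ∈ A.1] :
    valueAt c v = c.sum fun A k => if v ∈ A.1 then k else 0 := by
  unfold valueAt Finsupp.sum
  exact Finset.sum_congr rfl fun A _ => by congr

theorem valueAt_sub (c d : G.GenVertex →₀ R) (v : V) :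
    valueAt (c - d) v = valueAt c v - valueAt d v := by
  classical
  simp only [valueAt_eq_sum]
  exact Finsupp.sum_sub_index fun A a b => by split_ifs <;> simp

theorem combP_sub (c d : G.GenVertex →₀ R) : combP (c - d) = combP c - combP d :=
  Finsupp.sum_sub_index (h := fun A k => k • p R A) fun A a b => sub_smul a b (p R A)

theorem valueAt_sum_single (S : Finset V) (k : V → R) (v : V) (hv : v ∉ S → k v = 0) :
    valueAt (∑ x ∈ S, Finsupp.single (G.vert x) (k x)) v = k v := by
  classical
  rw [valueAt_eq_sum, ← Finsupp.sum_finsetSum_index (fun _ => by simp)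
    (fun A a b => by split_ifs <;> simp)]
  simp only [Finsupp.sum_single_index, ite_self]
  rw [Finset.sum_eq_single v]
  · exact if_pos rfl
  · intro x _ hx
    exact if_neg fun h => hx (Eq.symm h)
  · intro h
    rw [hv h, ite_self]

theorem combP_sum_single (S : Finset V) (k : V → R) :
    combP (∑ x ∈ S, Finsupp.single (G.vert x) (k x)) = ∑ x ∈ S, k x • p R (G.vert x) := by
  change Finsupp.sum _ (fun A k => k • p R A) = _
  rw [← Finsupp.sum_finsetSum_index (fun _ => by simp) (fun A a b => add_smul a b _)]
  exact Finset.sum_congr rfl fun x _ => Finsupp.sum_single_index (zero_smul _ _)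

/-- Both sides represent the same function on vertices, so `combP_eq_zero` applies to their
difference. -/
theorem combP_eq_sum_vert {c : G.GenVertex →₀ R} {S : Finset V}
    (h : ∀ v ∉ S, valueAt c v = 0) : combP c = ∑ v ∈ S, valueAt c v • p R (G.vert v) := by
  rw [← combP_sum_single, ← sub_eq_zero, ← combP_sub]
  refine combP_eq_zero fun v => ?_
  rw [valueAt_sub, valueAt_sum_single S _ v (h v), sub_self]

/-- Multiplication by `p_v` evaluates the represented function at `v`. -/
theorem combP_mul_p_vert (c : G.GenVertex →₀ R) (v : V) :
    combP c * p R (G.vert v) = valueAt c v • p R (G.vert v) := by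
  classical
  rw [combP, valueAt, Finset.sum_mul, Finset.sum_smul]
  refine Finset.sum_congr rfl fun A _ => ?_
  rw [smul_mul_assoc, p_mul_p, p_inter_vert]
  split_ifs <;> simp

theorem combP_mul_s (c : G.GenVertex →₀ R) (e : E) :
    combP c * s R e = valueAt c (G.s e) • s R e := by
  rw [← p_source_mul_s, ← mul_assoc, combP_mul_p_vert, smul_mul_assoc]

end Projections

end LeavittPathAlgebra

end Ultragraph

namespace Ultragraph

namespace LeavittPathAlgebra

/-! ### Passing faithfulness to shifted submodules. -/

section Faithful

variable {V : Type u} {E : Type v} {G : Ultragraph V E} {R : Type w} [CommRing R]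

/-- Stability under multiplication by the projections `p_B` from both sides. -/
structure IsPStable (C : Submodule R (LeavittPathAlgebra R G)) : Prop where
  p_mul : ∀ (B : G.GenVertex), ∀ x ∈ C, p R B * x ∈ C
  mul_p : ∀ (B : G.GenVertex), ∀ x ∈ C, x * p R B ∈ C

theorem IsPStable.sup {C D : Submodule R (LeavittPathAlgebra R G)} (hC : IsPStable C)
    (hD : IsPStable D) : IsPStable (C ⊔ D) where
  p_mul B x hx := by
    obtain ⟨y, hy, z, hz, rfl⟩ := Submodule.mem_sup.1 hx
    rw [mul_add]
    exact Submodule.add_mem_sup (hC.p_mul B y hy) (hD.p_mul B z hz)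
  mul_p B x hx := by
    obtain ⟨y, hy, z, hz, rfl⟩ := Submodule.mem_sup.1 hx
    rw [add_mul]
    exact Submodule.add_mem_sup (hC.mul_p B y hy) (hD.mul_p B z hz)

theorem IsPStable.iSup {ι : Sort*} {C : ι → Submodule R (LeavittPathAlgebra R G)}
    (hC : ∀ i, IsPStable (C i)) : IsPStable (⨆ i, C i) where
  p_mul B x hx := by
    induction hx using Submodule.iSup_induction' with
    | mem i x hx => exact Submodule.mem_iSup_of_mem i ((hC i).p_mul B x hx)
    | zero => rw [mul_zero]; exact zero_mem _
    | add x y _ _ ihx ihy => rw [mul_add]; exact add_mem ihx ihy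
  mul_p B x hx := by
    induction hx using Submodule.iSup_induction' with
    | mem i x hx => exact Submodule.mem_iSup_of_mem i ((hC i).mul_p B x hx)
    | zero => rw [zero_mul]; exact zero_mem _
    | add x y _ _ ihx ihy => rw [add_mul]; exact add_mem ihx ihy

variable (R) in
/-- Left multiplication by `s_e`. -/
noncomputable def sMul (e : E) : LeavittPathAlgebra R G →ₗ[R] LeavittPathAlgebra R G :=
  LinearMap.mulLeft R (s R e)

variable (R) in
/-- Right multiplication by `s_e^*`. -/
noncomputable def mulSStar (e : E) : LeavittPathAlgebra R G →ₗ[R] LeavittPathAlgebra R G :=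
  LinearMap.mulRight R (sStar R e)

theorem sMul_apply (e : E) (x : LeavittPathAlgebra R G) : sMul R e x = s R e * x := rfl

theorem mulSStar_apply (e : E) (x : LeavittPathAlgebra R G) : mulSStar R e x = x * sStar R e := rfl

theorem IsPStable.map_sMul {C : Submodule R (LeavittPathAlgebra R G)} (hC : IsPStable C) (e : E) :
    IsPStable (C.map (sMul R e)) where
  p_mul B x hx := by
    obtain ⟨y, hy, rfl⟩ := hx
    classical
    rw [sMul_apply, ← mul_assoc, p_mul_s]
    split_ifs
    · exact ⟨y, hy, rfl⟩
    · rw [zero_mul]; exact zero_mem _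
  mul_p B x hx := by
    obtain ⟨y, hy, rfl⟩ := hx
    exact ⟨y * p R B, hC.mul_p B y hy, (mul_assoc _ _ _).symm⟩

theorem IsPStable.map_mulSStar {C : Submodule R (LeavittPathAlgebra R G)} (hC : IsPStable C)
    (e : E) : IsPStable (C.map (mulSStar R e)) where
  mul_p B x hx := by
    obtain ⟨y, hy, rfl⟩ := hx
    classical
    rw [mulSStar_apply, mul_assoc, sStar_mul_p]
    split_ifs
    · exact ⟨y, hy, rfl⟩
    · rw [mul_zero]; exact zero_mem _
  p_mul B x hx := by
    obtain ⟨y, hy, rfl⟩ := hx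
    exact ⟨p R B * y, hC.p_mul B y hy, mul_assoc _ _ _⟩

variable {A : Type*} [NonUnitalRing A] [Module R A]

/-- `φ` is injective on the submodule `C`. -/
def FaithfulOn (φ : LeavittPathAlgebra R G →ₙₐ[R] A) (C : Submodule R (LeavittPathAlgebra R G)) :
    Prop :=
  ∀ x ∈ C, φ x = 0 → x = 0

variable {φ : LeavittPathAlgebra R G →ₙₐ[R] A} {C : Submodule R (LeavittPathAlgebra R G)}

/-- Left multiplication by `s_e^*` turns `s_e y` into `p_{r(e)} y`, which stays in `C` by stability
and still determines `s_e y = s_e p_{r(e)} y`. -/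
theorem FaithfulOn.map_sMul (h : FaithfulOn φ C) (hC : IsPStable C) (e : E) :
    FaithfulOn φ (C.map (sMul R e)) := by
  rintro _ ⟨y, hy, rfl⟩ h₀
  rw [sMul_apply] at h₀ ⊢
  have : p R (G.rng e) * y = 0 := h _ (hC.p_mul _ y hy) <| by
    rw [← sStar_mul_s_self, mul_assoc, map_mul, h₀, mul_zero]
  rw [← s_mul_p_rng, mul_assoc, this, mul_zero]

theorem FaithfulOn.map_mulSStar (h : FaithfulOn φ C) (hC : IsPStable C) (e : E) :
    FaithfulOn φ (C.map (mulSStar R e)) := by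
  rintro _ ⟨y, hy, rfl⟩ h₀
  rw [mulSStar_apply] at h₀ ⊢
  have : y * p R (G.rng e) = 0 := h _ (hC.mul_p _ y hy) <| by
    rw [← sStar_mul_s_self, ← mul_assoc, map_mul, h₀, zero_mul]
  rw [← p_rng_mul_sStar, ← mul_assoc, this, zero_mul]

end Faithful

/-! ### The diagonal subalgebra and faithfulness on it. -/

section Diagonal

variable {V : Type u} {E : Type v} (G : Ultragraph V E) (R : Type w) [CommRing R]

/-- The span of the elements `s_α p_A s_α^*` with `α` of length at most `n`. -/
noncomputable def diag : ℕ → Submodule R (LeavittPathAlgebra R G)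
  | 0 => Submodule.span R (Set.range (p R))
  | n + 1 => Submodule.span R (Set.range (p R)) ⊔
      ⨆ e : E, ((diag n).map (mulSStar R e)).map (sMul R e)

variable {G R}

theorem span_range_p_le_diag (n : ℕ) : Submodule.span R (Set.range (p R)) ≤ diag G R n := by
  cases n with
  | zero => exact le_rfl
  | succ n => exact le_sup_left

theorem p_mem_diag (A : G.GenVertex) (n : ℕ) : p R A ∈ diag G R n :=
  span_range_p_le_diag n (Submodule.subset_span ⟨A, rfl⟩)

theorem diag_le_succ (n : ℕ) : diag G R n ≤ diag G R (n + 1) := by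
  induction n with
  | zero => exact span_range_p_le_diag 1
  | succ n ih =>
    exact sup_le_sup_left (iSup_mono fun e => Submodule.map_mono (Submodule.map_mono ih)) _

theorem isPStable_span_range_p :
    IsPStable (Submodule.span R (Set.range (p R (G := G)))) where
  p_mul B x hx := by
    induction hx using Submodule.span_induction with
    | mem x hx =>
      obtain ⟨A, rfl⟩ := hx
      rw [p_mul_p]
      exact Submodule.subset_span ⟨_, rfl⟩
    | zero => rw [mul_zero]; exact zero_mem _
    | add x y _ _ ihx ihy => rw [mul_add]; exact add_mem ihx ihy
    | smul c x _ ih => rw [mul_smul_comm]; exact Submodule.smul_mem _ _ ih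
  mul_p B x hx := by
    induction hx using Submodule.span_induction with
    | mem x hx =>
      obtain ⟨A, rfl⟩ := hx
      rw [p_mul_p]
      exact Submodule.subset_span ⟨_, rfl⟩
    | zero => rw [zero_mul]; exact zero_mem _
    | add x y _ _ ihx ihy => rw [add_mul]; exact add_mem ihx ihy
    | smul c x _ ih => rw [smul_mul_assoc]; exact Submodule.smul_mem _ _ ih

theorem isPStable_diag (n : ℕ) : IsPStable (diag G R n) := by
  induction n with
  | zero => exact isPStable_span_range_p
  | succ n ih =>
    exact isPStable_span_range_p.sup (.iSup fun e => (ih.map_mulSStar e).map_sMul e)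

theorem exists_combP_of_mem_span {x : LeavittPathAlgebra R G}
    (hx : x ∈ Submodule.span R (Set.range (p R))) : ∃ c, x = combP c := by
  obtain ⟨c, rfl⟩ := Finsupp.mem_span_range_iff_exists_finsupp.1 hx
  exact ⟨c, rfl⟩

theorem exists_eq_of_mem_diag_succ {n : ℕ} {x : LeavittPathAlgebra R G}
    (hx : x ∈ diag G R (n + 1)) :
    ∃ (c : G.GenVertex →₀ R) (F : Finset E) (d : E → LeavittPathAlgebra R G),
      (∀ e, d e ∈ diag G R n) ∧ (∀ e ∉ F, d e = 0) ∧
      x = combP c + ∑ e ∈ F, s R e * (d e * sStar R e) := by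
  classical
  obtain ⟨y, hy, z, hz, rfl⟩ := Submodule.mem_sup.1 hx
  obtain ⟨c, rfl⟩ := exists_combP_of_mem_span hy
  obtain ⟨f, hf, rfl⟩ := (Submodule.mem_iSup_iff_exists_finsupp _ _).1 hz
  choose b hb hbf using hf
  choose d hd hdb using hb
  -- The chosen preimages of zero need not vanish, so they are replaced by zero off the support.
  refine ⟨c, f.support, fun e => if e ∈ f.support then d e else 0, fun e => ?_, fun e he => if_neg he,
    congrArg _ (Finset.sum_congr rfl fun e he => ?_)⟩
  · dsimp only
    split_ifs
    · exact hd e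
    · exact zero_mem _
  · dsimp only [id]
    rw [if_pos he, ← hbf e, ← hdb e]
    rfl

variable {A : Type*} [NonUnitalRing A] [Module R A] {φ : LeavittPathAlgebra R G →ₙₐ[R] A}

theorem eq_zero_of_smul_p (h : ∀ (v : V) (c : R), φ (c • p R (G.vert v)) = 0 → c = 0)
    {B : G.GenVertex} {v : V} (hv : v ∈ B.1) {c : R} (hc : φ (c • p R B) = 0) : c = 0 := by
  classical
  refine h v c ?_
  have : c • p R (G.vert v) = c • p R B * p R (G.vert v) := by
    rw [smul_mul_assoc, p_mul_p, p_inter_vert, if_pos hv]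
  rw [this, map_mul, hc, zero_mul]

/-- Compressing by `s_e^*` and `s_e` leaves `c p_{r(e)}`, and `r(e)` contains a vertex to test on.
-/
theorem eq_zero_of_smul_s_mul_sStar
    (h : ∀ (v : V) (c : R), φ (c • p R (G.vert v)) = 0 → c = 0)
    {e : E} {c : R} (hc : c • (s R e * sStar R e) = (0 : LeavittPathAlgebra R G)) : c = 0 := by
  obtain ⟨v, hv⟩ := G.r_nonempty e
  refine eq_zero_of_smul_p h (B := G.rng e) hv ?_
  have : c • p R (G.rng e) = sStar R e * (c • (s R e * sStar R e)) * s R e := by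
    rw [mul_smul_comm, smul_mul_assoc, ← mul_assoc (sStar R e), mul_assoc (sStar R e * s R e),
      sStar_mul_s_self, p_mul_p]
    congr 2
    exact GenVertex.ext fun x => ⟨fun hx => ⟨hx, hx⟩, fun hx => hx.1⟩
  rw [this, hc, mul_zero, zero_mul, map_zero]

theorem faithfulOn_span_range_p (h : ∀ (v : V) (c : R), φ (c • p R (G.vert v)) = 0 → c = 0) :
    FaithfulOn φ (Submodule.span R (Set.range (p R))) := by
  intro x hx h₀
  obtain ⟨c, rfl⟩ := exists_combP_of_mem_span hx
  refine combP_eq_zero fun v => h v _ ?_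
  rw [← combP_mul_p_vert, map_mul, h₀, zero_mul]

/-- Write a kernel element as `∑ c_A p_A + ∑_{e ∈ F} s_e d_e s_e^*`. Its corners `s_f^* x s_f` lie
one level lower, hence vanish by induction, which expresses each `s_f d_f s_f^*` through the value
of `c` at `s(f)`. What remains is a combination of the elements `p_v - ∑_{e ∈ F, s(e) = v} s_e
s_e^*`. Wherever the coefficient is nonzero, `F` contains all edges leaving `v`, so relation (4)
finishes the proof. -/
theorem faithfulOn_diag (h : ∀ (v : V) (c : R), φ (c • p R (G.vert v)) = 0 → c = 0) (n : ℕ) :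
    FaithfulOn φ (diag G R n) := by
  classical
  induction n with
  | zero => exact faithfulOn_span_range_p h
  | succ n ih =>
  intro x hx h₀
  obtain ⟨c, F, d, hd, hF, hxe⟩ := exists_eq_of_mem_diag_succ hx
  have hcorner (f : E) : valueAt c (G.s f) • (s R f * sStar R f) + s R f * (d f * sStar R f) = 0 := by
    have e₁ : sStar R f * x * s R f =
        valueAt c (G.s f) • p R (G.rng f) + p R (G.rng f) * d f * p R (G.rng f) := by
      rw [hxe, mul_add, add_mul]
      congr 1
      · rw [mul_assoc, combP_mul_s, mul_smul_comm, sStar_mul_s_self]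
      · rw [Finset.mul_sum, Finset.sum_mul, Finset.sum_eq_single f]
        · rw [← sStar_mul_s_self]
          simp only [mul_assoc]
        · intro e _ hef
          rw [← mul_assoc, sStar_mul_s_of_ne R hef.symm, zero_mul, zero_mul]
        · intro hf
          rw [hF f hf, zero_mul, mul_zero, mul_zero, zero_mul]
    have e₂ : sStar R f * x * s R f = 0 := by
      refine ih _ ?_ ?_
      · rw [e₁]
        exact add_mem (Submodule.smul_mem _ _ (p_mem_diag _ n))
          ((isPStable_diag n).mul_p _ _ ((isPStable_diag n).p_mul _ _ (hd f)))
      · rw [map_mul, map_mul, h₀, mul_zero, zero_mul]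
    have e₃ : s R f * (sStar R f * x * s R f) * sStar R f = 0 := by
      rw [e₂, mul_zero, zero_mul]
    rw [e₁, mul_add, mul_smul_comm, s_mul_p_rng, ← mul_assoc, ← mul_assoc, s_mul_p_rng, add_mul,
      mul_assoc _ (p R (G.rng f)), p_rng_mul_sStar, smul_mul_assoc, mul_assoc] at e₃
    exact e₃
  -- Only finitely many edges lie in `F`. For any other edge `d_f = 0`, so the corner identity
  -- forces the value at its source to vanish.
  have hvalue (f : E) (hf : f ∉ F) : valueAt c (G.s f) = 0 := by
    have := hcorner f
    rw [hF f hf, zero_mul, mul_zero, add_zero] at this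
    exact eq_zero_of_smul_s_mul_sStar h this
  have hsink (v : V) (hv : ¬ (G.out v).Nonempty) : valueAt c v = 0 := by
    refine h v _ ?_
    have : x * p R (G.vert v) = valueAt c v • p R (G.vert v) := by
      rw [hxe, add_mul, combP_mul_p_vert, Finset.sum_mul, Finset.sum_eq_zero, add_zero]
      intro e _
      rw [mul_assoc, mul_assoc, sStar_mul_p, if_neg, mul_zero, mul_zero]
      exact fun hev => hv ⟨e, hev⟩
    rw [← this, map_mul, h₀, zero_mul]
  have hsupp (v : V) (hv : v ∉ F.image G.s) : valueAt c v = 0 := by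
    by_cases hne : (G.out v).Nonempty
    · obtain ⟨f, rfl⟩ := hne
      exact hvalue f fun hf => hv (Finset.mem_image_of_mem _ hf)
    · exact hsink v hne
  have hsum : ∑ e ∈ F, s R e * (d e * sStar R e) =
      - ∑ v ∈ F.image G.s, ∑ e ∈ F with G.s e = v, valueAt c (G.s e) • (s R e * sStar R e) := by
    rw [Finset.sum_fiberwise_of_maps_to (g := G.s) fun e he => Finset.mem_image_of_mem _ he,
      ← Finset.sum_neg_distrib]
    exact Finset.sum_congr rfl fun e _ => eq_neg_of_add_eq_zero_right (hcorner e)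
  rw [hxe, hsum, combP_eq_sum_vert hsupp, ← sub_eq_add_neg, ← Finset.sum_sub_distrib]
  refine Finset.sum_eq_zero fun v hv => sub_eq_zero.2 ?_
  have e₁ : ∑ e ∈ F with G.s e = v, valueAt c (G.s e) • (s R e * sStar R e) =
      valueAt c v • ∑ e ∈ F with G.s e = v, (s R e * sStar R e : LeavittPathAlgebra R G) := by
    rw [Finset.smul_sum]
    exact Finset.sum_congr rfl fun e he => by rw [(Finset.mem_filter.1 he).2]
  rw [e₁]
  by_cases hv₀ : valueAt c v = 0
  · rw [hv₀, zero_smul, zero_smul]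
  -- An edge leaving `v` outside `F` would make the value at `v` zero; hence `v` emits finitely many
  -- edges, all in `F`.
  have hout : G.out v = ↑(F.filter fun e => G.s e = v) := by
    ext e
    refine ⟨fun he => ?_, fun he => (Finset.mem_filter.1 he).2⟩
    refine Finset.mem_coe.2 (Finset.mem_filter.2 ⟨?_, he⟩)
    by_contra heF
    exact hv₀ (by rw [← hvalue e heF, show G.s e = v from he])
  have hfin : (G.out v).Finite := hout ▸ Finset.finite_toSet _
  have hne : (G.out v).Nonempty := by
    obtain ⟨e, _, he⟩ := Finset.mem_image.1 hv
    exact ⟨e, he⟩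
  rw [p_vert_eq_sum R v hfin hne]
  congr 2
  apply Finset.coe_injective
  rw [hfin.coe_toFinset, hout]

variable (G R) in
/-- The span of all elements `s_α p_A s_α^*`. -/
noncomputable def diagonal : Submodule R (LeavittPathAlgebra R G) := ⨆ n, diag G R n

theorem isPStable_diagonal : IsPStable (diagonal G R) :=
  .iSup isPStable_diag

theorem mem_diagonal {x : LeavittPathAlgebra R G} : x ∈ diagonal G R ↔ ∃ n, x ∈ diag G R n :=
  Submodule.mem_iSup_of_directed _ (monotone_nat_of_le_succ diag_le_succ).directed_le

theorem p_mem_diagonal (A : G.GenVertex) : p R A ∈ diagonal G R :=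
  mem_diagonal.2 ⟨0, p_mem_diag A 0⟩

theorem faithfulOn_diagonal (h : ∀ (v : V) (c : R), φ (c • p R (G.vert v)) = 0 → c = 0) :
    FaithfulOn φ (diagonal G R) := fun x hx =>
  let ⟨n, hn⟩ := mem_diagonal.1 hx
  faithfulOn_diag h n x hn

theorem s_mul_diagonal_mul_sStar (e : E) {x : LeavittPathAlgebra R G} (hx : x ∈ diagonal G R) :
    s R e * (x * sStar R e) ∈ diagonal G R := by
  obtain ⟨n, hn⟩ := mem_diagonal.1 hx
  exact mem_diagonal.2 ⟨n + 1, Submodule.mem_sup_right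
    (Submodule.mem_iSup_of_mem e ⟨_, ⟨x, hn, rfl⟩, rfl⟩)⟩

/-- A ghost edge passes through the diagonal: `s_e^* p_A` is `0` or `p_{r(e)} s_e^*`, and `s_e^*
(s_f d s_f^*)` is `0` or `(p_{r(e)} d) s_e^*`. -/
theorem sStar_mul_diagonal (e : E) {x : LeavittPathAlgebra R G} (hx : x ∈ diagonal G R) :
    sStar R e * x ∈ (diagonal G R).map (mulSStar R e) := by
  classical
  have hspan : ∀ x ∈ Submodule.span R (Set.range (p R)),
      sStar R e * x ∈ (diagonal G R).map (mulSStar R e) := by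
    intro x hx
    induction hx using Submodule.span_induction with
    | mem x hx =>
      obtain ⟨A, rfl⟩ := hx
      rw [sStar_mul_p]
      split_ifs
      · exact ⟨p R (G.rng e), p_mem_diagonal _, p_rng_mul_sStar R e⟩
      · exact zero_mem _
    | zero => rw [mul_zero]; exact zero_mem _
    | add x y _ _ ihx ihy => rw [mul_add]; exact add_mem ihx ihy
    | smul c x _ ih => rw [mul_smul_comm]; exact Submodule.smul_mem _ _ ih
  obtain ⟨n, hn⟩ := mem_diagonal.1 hx
  cases n with
  | zero => exact hspan x hn
  | succ n =>
    obtain ⟨y, hy, z, hz, rfl⟩ := Submodule.mem_sup.1 hn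
    rw [mul_add]
    refine add_mem (hspan y hy) ?_
    clear hx hn
    induction hz using Submodule.iSup_induction' with
    | mem f x hx =>
      obtain ⟨_, ⟨x, hx, rfl⟩, rfl⟩ := hx
      rw [sMul_apply, mulSStar_apply, ← mul_assoc]
      by_cases hef : e = f
      · subst hef
        rw [sStar_mul_s_self, ← mul_assoc]
        exact ⟨_, isPStable_diagonal.p_mul _ _ (mem_diagonal.2 ⟨n, hx⟩), rfl⟩
      · rw [sStar_mul_s_of_ne R hef, zero_mul]
        exact zero_mem _
    | zero => rw [mul_zero]; exact zero_mem _
    | add x y _ _ ihx ihy => rw [mul_add]; exact add_mem ihx ihy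

end Diagonal

end LeavittPathAlgebra

end Ultragraph

namespace Ultragraph

/-! ### Reduced pairs of words in the free group. -/

section Words

variable {E : Type v}

/-- The two words do not end in the same letter. -/
def NoCommonEnd (q : List E × List E) : Prop :=
  ∀ e ∈ q.1.getLast?, e ∉ q.2.getLast?

/-- The element `μ ν⁻¹` of the free group. -/
def wordDegree (q : List E × List E) : FreeGroup E :=
  (q.1.map FreeGroup.of).prod * (q.2.map FreeGroup.of).prod⁻¹

theorem prod_map_of (μ : List E) :
    (μ.map FreeGroup.of).prod = FreeGroup.mk (μ.map fun e => (e, true)) := by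
  induction μ with
  | nil => rfl
  | cons e μ ih => rw [List.map_cons, List.prod_cons, ih]; rfl

/-- Signs agree within each half, so cancellation could occur only at the junction, where the last
letters of the two words meet. -/
theorem toWord_wordDegree {q : List E × List E} (hq : NoCommonEnd q) [DecidableEq E] :
    (wordDegree q).toWord =
      q.1.map (fun e => (e, true)) ++ (q.2.map fun e => (e, false)).reverse := by
  have h : wordDegree q = FreeGroup.mk
      (q.1.map (fun e => (e, true)) ++ (q.2.map fun e => (e, false)).reverse) := by
    rw [wordDegree, prod_map_of, prod_map_of, FreeGroup.inv_mk, FreeGroup.mul_mk]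
    simp [FreeGroup.invRev, Function.comp_def]
  rw [h, FreeGroup.toWord_mk]
  refine FreeGroup.IsReduced.reduce_eq (List.isChain_append.2 ⟨?_, ?_, ?_⟩)
  · exact (List.pairwise_map.2 (List.pairwise_of_forall fun _ _ _ => rfl)).isChain
  · rw [← List.map_reverse]
    exact (List.pairwise_map.2 (List.pairwise_of_forall fun _ _ _ => rfl)).isChain
  · intro x hx y hy hxy
    rw [List.head?_reverse] at hy
    simp only [List.getLast?_map, Option.mem_def, Option.map_eq_some_iff] at hx hy
    obtain ⟨a, ha, rfl⟩ := hx
    obtain ⟨b, hb, rfl⟩ := hy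
    obtain rfl : a = b := hxy
    exact (hq a ha hb).elim

theorem wordDegree_injective {q r : List E × List E} (hq : NoCommonEnd q) (hr : NoCommonEnd r)
    (h : wordDegree q = wordDegree r) : q = r := by
  classical
  have hw := congrArg FreeGroup.toWord h
  rw [toWord_wordDegree hq, toWord_wordDegree hr] at hw
  -- The positive letters recover the first word, the negative ones the second.
  have h₁ := congrArg (List.filterMap fun a : E × Bool => if a.2 then some a.1 else none) hw
  have h₂ := congrArg (List.filterMap fun a : E × Bool => if a.2 then none else some a.1) hw
  simp [List.filterMap_map, ← List.map_reverse] at h₁ h₂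
  exact Prod.ext h₁ h₂

end Words

namespace LeavittPathAlgebra

/-! ### Block decomposition and graded uniqueness. -/

section GradedUniqueness

variable {V : Type u} {E : Type v} {G : Ultragraph V E} {R : Type w} [CommRing R]

/-- The submodule `s_μ C`. -/
noncomputable def leftShift (μ : List E) (C : Submodule R (LeavittPathAlgebra R G)) :
    Submodule R (LeavittPathAlgebra R G) :=
  μ.foldr (fun e D => D.map (sMul R e)) C

/-- The submodule `C s_ν^*`. -/
noncomputable def rightShift (ν : List E) (C : Submodule R (LeavittPathAlgebra R G)) :
    Submodule R (LeavittPathAlgebra R G) :=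
  ν.foldr (fun e D => D.map (mulSStar R e)) C

theorem rightShift_concat (ν : List E) (e : E) (C : Submodule R (LeavittPathAlgebra R G)) :
    rightShift (ν ++ [e]) C = rightShift ν (C.map (mulSStar R e)) :=
  List.foldr_append

theorem mul_mem_rightShift {a : LeavittPathAlgebra R G}
    {C D : Submodule R (LeavittPathAlgebra R G)} (h : ∀ x ∈ C, a * x ∈ D) (ν : List E) :
    ∀ x ∈ rightShift ν C, a * x ∈ rightShift ν D := by
  induction ν with
  | nil => exact h
  | cons e ν ih =>
    rintro _ ⟨y, hy, rfl⟩
    exact ⟨a * y, ih y hy, mul_assoc _ _ _⟩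

theorem IsPStable.leftShift {C : Submodule R (LeavittPathAlgebra R G)} (hC : IsPStable C)
    (μ : List E) : IsPStable (leftShift μ C) := by
  induction μ with
  | nil => exact hC
  | cons e μ ih => exact ih.map_sMul e

theorem IsPStable.rightShift {C : Submodule R (LeavittPathAlgebra R G)} (hC : IsPStable C)
    (ν : List E) : IsPStable (rightShift ν C) := by
  induction ν with
  | nil => exact hC
  | cons e ν ih => exact ih.map_mulSStar e

variable (G R) in
/-- The span of the elements `s_μ s_α p_A s_α^* s_ν^*`. -/
noncomputable def block (q : List E × List E) : Submodule R (LeavittPathAlgebra R G) :=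
  leftShift q.1 (rightShift q.2 (diagonal G R))

theorem isPStable_block (q : List E × List E) : IsPStable (block G R q) :=
  (isPStable_diagonal.rightShift q.2).leftShift q.1

variable (G R) in
/-- The sum of the blocks of all reduced pairs of words. -/
noncomputable def blockSum : Submodule R (LeavittPathAlgebra R G) :=
  ⨆ q : {q : List E × List E // NoCommonEnd q}, block G R q

theorem block_le_blockSum {q : List E × List E} (hq : NoCommonEnd q) :
    block G R q ≤ blockSum G R :=
  le_iSup (fun q : {q : List E × List E // NoCommonEnd q} => block G R q) ⟨q, hq⟩

/-- Prepending `e` spoils the condition only if `μ` is empty and `ν` ends in `e`. Then that last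
ghost edge sits next to the diagonal, and `s_e D s_e^* ⊆ D` absorbs both. -/
theorem s_mul_block (e : E) {q : List E × List E} (hq : NoCommonEnd q)
    {x : LeavittPathAlgebra R G} (hx : x ∈ block G R q) : s R e * x ∈ blockSum G R := by
  obtain ⟨μ, ν⟩ := q
  by_cases h : NoCommonEnd (e :: μ, ν)
  · exact block_le_blockSum h ⟨x, hx, rfl⟩
  cases μ with
  | cons f μ =>
    refine (h fun a ha => hq a ?_).elim
    simpa [List.getLast?_cons_cons] using ha
  | nil =>
    have he : e ∈ ν.getLast? := by
      simpa [NoCommonEnd] using h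
    obtain ⟨ν, rfl⟩ := List.mem_getLast?_eq_getLast he |>.elim fun hne heq =>
      (⟨ν.dropLast, by rw [heq, List.dropLast_append_getLast]⟩ : ∃ ν', ν = ν' ++ [e])
    have hx : x ∈ rightShift (ν ++ [e]) (diagonal G R) := hx
    rw [rightShift_concat] at hx
    refine block_le_blockSum (q := ([], ν)) (fun a ha => by simp at ha)
      (mul_mem_rightShift ?_ ν x hx)
    rintro _ ⟨y, hy, rfl⟩
    exact s_mul_diagonal_mul_sStar e hy

/-- If `μ` is nonempty, `s_e^*` cancels its first letter or gives zero. If `μ` is empty, it crosses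
the diagonal and becomes the new last letter of `ν`. -/
theorem sStar_mul_block (e : E) {q : List E × List E} (hq : NoCommonEnd q)
    {x : LeavittPathAlgebra R G} (hx : x ∈ block G R q) : sStar R e * x ∈ blockSum G R := by
  obtain ⟨μ, ν⟩ := q
  cases μ with
  | cons f μ =>
    obtain ⟨y, hy, rfl⟩ := hx
    rw [sMul_apply, ← mul_assoc]
    by_cases hef : e = f
    · subst hef
      rw [sStar_mul_s_self]
      refine block_le_blockSum (q := (μ, ν)) (fun a ha => hq a ?_)
        ((isPStable_block (μ, ν)).p_mul _ _ hy)
      cases μ with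
      | nil => simp at ha
      | cons g μ => simpa [List.getLast?_cons_cons] using ha
    · rw [sStar_mul_s_of_ne R hef, zero_mul]
      exact zero_mem _
  | nil =>
    refine block_le_blockSum (q := ([], ν ++ [e])) (fun a ha => by simp at ha) ?_
    change _ ∈ rightShift (ν ++ [e]) (diagonal G R)
    rw [rightShift_concat]
    exact mul_mem_rightShift (fun y hy => sStar_mul_diagonal e hy) ν x hx

theorem mul_mem_blockSum {a : LeavittPathAlgebra R G}
    (h : ∀ q, NoCommonEnd q → ∀ x ∈ block G R q, a * x ∈ blockSum G R)
    {x : LeavittPathAlgebra R G} (hx : x ∈ blockSum G R) : a * x ∈ blockSum G R := by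
  unfold blockSum at hx
  induction hx using Submodule.iSup_induction' with
  | mem q x hx => exact h q.1 q.2 x hx
  | zero => rw [mul_zero]; exact zero_mem _
  | add x y _ _ ihx ihy => rw [mul_add]; exact add_mem ihx ihy

theorem gen_mul_mem_blockSum (g : G.Gen) {x : LeavittPathAlgebra R G} (hx : x ∈ blockSum G R) :
    mkHom R G (FreeAlg.gen R g) * x ∈ blockSum G R := by
  refine mul_mem_blockSum (fun q hq y hy => ?_) hx
  cases g with
  | edge e => exact s_mul_block e hq hy
  | ghost e => exact sStar_mul_block e hq hy
  | proj A => exact block_le_blockSum hq ((isPStable_block q).p_mul A y hy)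

/-- In the absence of a unit, `s_e` and `s_e^*` are reached by acting on projections: `s_e = s_e
p_{r(e)}` and `s_e^* = s_e^* p_{s(e)}`. -/
theorem gen_mem_blockSum (g : G.Gen) : mkHom R G (FreeAlg.gen R g) ∈ blockSum G R := by
  have hp (A : G.GenVertex) : p R A ∈ blockSum G R :=
    block_le_blockSum (q := ([], [])) (fun a ha => by simp at ha) (p_mem_diagonal A)
  cases g with
  | edge e =>
    have := gen_mul_mem_blockSum (.edge e) (hp (G.rng e))
    rwa [show mkHom R G (FreeAlg.gen R (.edge e)) = s R e from rfl, s_mul_p_rng] at this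
  | ghost e =>
    have := gen_mul_mem_blockSum (.ghost e) (hp (G.vert (G.s e)))
    rwa [show mkHom R G (FreeAlg.gen R (.ghost e)) = sStar R e from rfl, sStar_mul_p_source] at this
  | proj A => exact hp A

theorem mem_blockSum (x : LeavittPathAlgebra R G) : x ∈ blockSum G R := by
  obtain ⟨x, rfl⟩ : ∃ y, mkHom R G y = x := mk_surjective x
  have hw (w : FreeSemigroup G.Gen) :
      mkHom R G (MonoidAlgebra.single w 1) ∈ blockSum G R := by
    induction w using FreeSemigroup.recOnMul with
    | ih1 g => exact gen_mem_blockSum g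
    | ih2 g w _ ih =>
      rw [← one_mul (1 : R), ← MonoidAlgebra.single_mul_single, map_mul]
      exact gen_mul_mem_blockSum g ih
  induction x using MonoidAlgebra.induction_linear with
  | zero => rw [map_zero]; exact zero_mem _
  | add x y hx hy => rw [map_add]; exact add_mem hx hy
  | single w c =>
    rw [show MonoidAlgebra.single w c = c • (MonoidAlgebra.single w 1 : FreeAlg R G) by simp,
      map_smul]
    exact Submodule.smul_mem _ _ (hw w)

variable {A : Type*} [NonUnitalRing A] [Module R A] {φ : LeavittPathAlgebra R G →ₙₐ[R] A}

theorem faithfulOn_block (h : ∀ (v : V) (c : R), φ (c • p R (G.vert v)) = 0 → c = 0)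
    (q : List E × List E) : FaithfulOn φ (block G R q) := by
  have h₁ (ν : List E) : FaithfulOn φ (rightShift ν (diagonal G R)) := by
    induction ν with
    | nil => exact faithfulOn_diagonal h
    | cons e ν ih => exact ih.map_mulSStar (isPStable_diagonal.rightShift ν) e
  obtain ⟨μ, ν⟩ := q
  induction μ with
  | nil => exact h₁ ν
  | cons e μ ih => exact ih.map_sMul (isPStable_block (μ, ν)) e

/-- Gradings of the target by the free group on the edges which are compatible with `φ`. -/
structure IsCompatibleGrading (φ : LeavittPathAlgebra R G →ₙₐ[R] A)
    (𝒜 : FreeGroup E → Submodule R A) : Prop where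
  indep : iSupIndep 𝒜
  mul_mem : ∀ {g h : FreeGroup E} {a b : A}, a ∈ 𝒜 g → b ∈ 𝒜 h → a * b ∈ 𝒜 (g * h)
  map_s : ∀ e, φ (s R e) ∈ 𝒜 (FreeGroup.of e)
  map_sStar : ∀ e, φ (sStar R e) ∈ 𝒜 (FreeGroup.of e)⁻¹
  map_p : ∀ B, φ (p R B) ∈ 𝒜 1

variable {𝒜 : FreeGroup E → Submodule R A}

theorem IsCompatibleGrading.map_diag (h𝒜 : IsCompatibleGrading φ 𝒜) (n : ℕ) :
    ∀ x ∈ diag G R n, φ x ∈ 𝒜 1 := by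
  have hspan : Submodule.span R (Set.range (p R)) ≤ (𝒜 1).comap (φ : LeavittPathAlgebra R G →ₗ[R] A) :=
    Submodule.span_le.2 (by rintro _ ⟨B, rfl⟩; exact h𝒜.map_p B)
  change diag G R n ≤ (𝒜 1).comap (φ : LeavittPathAlgebra R G →ₗ[R] A)
  induction n with
  | zero => exact hspan
  | succ n ih =>
    refine sup_le hspan (iSup_le fun e => ?_)
    rintro _ ⟨_, ⟨x, hx, rfl⟩, rfl⟩
    change φ (s R e * (x * sStar R e)) ∈ 𝒜 1
    rw [map_mul, map_mul]
    simpa using h𝒜.mul_mem (h𝒜.map_s e) (h𝒜.mul_mem (ih hx) (h𝒜.map_sStar e))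

theorem IsCompatibleGrading.map_block (h𝒜 : IsCompatibleGrading φ 𝒜) (q : List E × List E) :
    ∀ x ∈ block G R q, φ x ∈ 𝒜 (wordDegree q) := by
  have h₁ (ν : List E) : ∀ x ∈ rightShift ν (diagonal G R),
      φ x ∈ 𝒜 (ν.map FreeGroup.of).prod⁻¹ := by
    induction ν with
    | nil =>
      intro x hx
      obtain ⟨n, hn⟩ := mem_diagonal.1 hx
      simpa using h𝒜.map_diag n x hn
    | cons e ν ih =>
      rintro _ ⟨y, hy, rfl⟩
      rw [mulSStar_apply, map_mul, List.map_cons, List.prod_cons, mul_inv_rev]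
      exact h𝒜.mul_mem (ih y hy) (h𝒜.map_sStar e)
  obtain ⟨μ, ν⟩ := q
  induction μ with
  | nil =>
    intro x hx
    simpa [wordDegree] using h₁ ν x hx
  | cons e μ ih =>
    rintro _ ⟨y, hy, rfl⟩
    rw [sMul_apply, map_mul, wordDegree, List.map_cons, List.prod_cons, mul_assoc]
    exact h𝒜.mul_mem (h𝒜.map_s e) (ih y hy)

/-- A graded uniqueness theorem. -/
theorem IsCompatibleGrading.injective (h𝒜 : IsCompatibleGrading φ 𝒜)
    (h : ∀ (v : V) (c : R), φ (c • p R (G.vert v)) = 0 → c = 0) : Function.Injective φ := by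
  refine (injective_iff_map_eq_zero φ).2 fun x hx => ?_
  obtain ⟨f, hf, rfl⟩ := (Submodule.mem_iSup_iff_exists_finsupp _ _).1 (mem_blockSum x)
  have hinj : Function.Injective
      fun q : {q : List E × List E // NoCommonEnd q} => wordDegree q.1 :=
    fun q r hqr => Subtype.ext (wordDegree_injective q.2 r.2 hqr)
  -- The images of the block components have pairwise distinct degrees and sum to zero, so each is
  -- zero.
  have hzero := (iSupIndep_iff_finsetSum_eq_zero_imp_eq_zero _).1 (h𝒜.indep.comp hinj) f.support
    (fun q => φ (f q)) (fun q _ => h𝒜.map_block q.1 _ (hf q)) (by rw [← map_sum]; exact hx)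
  exact Finset.sum_eq_zero fun q hq => faithfulOn_block h q.1 _ (hf q) (hzero q hq)

end GradedUniqueness

end LeavittPathAlgebra

end Ultragraph

namespace Ultragraph

/-! ### Construction of the branching system. -/

variable {V : Type u} {E : Type v}

/-- A choice, at each vertex which is not a sink, of a partition of `ℕ` into infinite sets indexed
by the outgoing edges. -/
structure EdgePartition (G : Ultragraph V E) where
  part : E → Set ℕ
  infinite : ∀ e, (part e).Infinite
  disjoint : ∀ e f n, G.s e = G.s f → n ∈ part e → n ∈ part f → e = f
  cover : ∀ e n, ∃ f, G.s f = G.s e ∧ n ∈ part f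

theorem mem_out_source (G : Ultragraph V E) (e : E) : e ∈ G.out (G.s e) :=
  rfl

/-- Enumerations of the edges with the same source as a given edge, depending only on that
source. -/
theorem exists_enumeration (G : Ultragraph V E) (hs : ∀ v, (G.out v).Countable) :
    ∃ t : E → ℕ → E, (∀ e, G.out (G.s e) = Set.range (t e)) ∧ ∀ e f, G.s e = G.s f → t e = t f := by
  have (v : V) (hv : (G.out v).Nonempty) : ∃ t : ℕ → E, G.out v = Set.range t :=
    (hs v).exists_eq_range hv
  choose t ht using this
  have hts (v w : V) (h : v = w) (hv : (G.out v).Nonempty) (hw : (G.out w).Nonempty) :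
      t v hv = t w hw := by
    subst h
    rfl
  exact ⟨fun e => t (G.s e) ⟨e, G.mem_out_source e⟩, fun e => ht _ _, fun e f h => hts _ _ h _ _⟩

theorem exists_edgePartition (G : Ultragraph V E) (hs : ∀ v, (G.out v).Countable) :
    Nonempty G.EdgePartition := by
  obtain ⟨t, ht, hts⟩ := G.exists_enumeration hs
  -- The first coordinate of `n` under the pairing names an edge and the second is free, so every
  -- class is infinite even if the enumeration repeats edges.
  refine ⟨⟨fun e => {n | t e n.unpair.1 = e}, fun e => ?_, fun e f n h he hf => ?_, fun e n => ?_⟩⟩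
  · obtain ⟨k, hk⟩ : e ∈ Set.range (t e) := ht e ▸ G.mem_out_source e
    refine Set.infinite_of_injective_forall_mem (f := fun m : ℕ => Nat.pair k m)
      (fun a b hab => (Nat.pair_eq_pair.1 hab).2) fun m => ?_
    rw [Set.mem_ofPred_eq, Nat.unpair_pair]
    exact hk
  · rw [Set.mem_ofPred_eq] at he hf
    rw [← he, ← hf, hts e f h]
  · have : t e n.unpair.1 ∈ G.out (G.s e) := (ht e).symm ▸ Set.mem_range_self _
    exact ⟨t e n.unpair.1, this, congrFun (hts _ _ this) _⟩

/-- Both sides are countably infinite; the factor `ℕ` ensures this even when `r(e)` is finite. -/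
theorem EdgePartition.exists_equiv {G : Ultragraph V E} (P : G.EdgePartition)
    (hr : ∀ e, (G.r e).Countable) (e : E) : Nonempty (G.r e × ℕ ≃ P.part e) := by
  have := (hr e).to_subtype
  have := (G.r_nonempty e).to_subtype
  have := (P.infinite e).to_subtype
  exact nonempty_equiv_of_countable

/-- The branching system on `V × ℕ × FreeGroup E` whose map `f_e` multiplies the last coordinate
by `e`. -/
noncomputable def freeBranchingSystem (G : Ultragraph V E) (P : G.EdgePartition)
    (j : ∀ e, G.r e × ℕ ≃ P.part e) : G.BranchingSystem (V × ℕ × FreeGroup E) where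
  R e := {x | x.1 = G.s e ∧ x.2.1 ∈ P.part e}
  D A := {x | x.1 ∈ A.1}
  R_disjoint e f hef := Set.eq_empty_of_forall_notMem fun x hx =>
    hef (P.disjoint e f x.2.1 (hx.1.1.symm.trans hx.2.1) hx.1.2 hx.2.2)
  D_empty := rfl
  D_inter _ _ := rfl
  D_union _ _ := rfl
  R_subset _ _ hx := hx.1
  D_vert v _ hne := by
    ext x
    refine ⟨fun hx => ?_, fun hx => ?_⟩
    · obtain ⟨e, rfl⟩ := hne
      obtain ⟨f, hf, hn⟩ := P.cover e x.2.1
      exact Set.mem_iUnion₂.2 ⟨f, hf, Eq.trans hx hf.symm, hn⟩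
    · obtain ⟨e, rfl, hxe⟩ := Set.mem_iUnion₂.1 hx
      exact hxe.1
  f e :=
    { toFun := fun x =>
        ⟨(G.s e, j e (⟨x.1.1, x.2⟩, x.1.2.1), FreeGroup.of e * x.1.2.2), rfl, (j e _).2⟩
      invFun := fun x =>
        ⟨(((j e).symm ⟨x.1.2.1, x.2.2⟩).1, ((j e).symm ⟨x.1.2.1, x.2.2⟩).2,
          (FreeGroup.of e)⁻¹ * x.1.2.2), ((j e).symm ⟨x.1.2.1, x.2.2⟩).1.2⟩
      left_inv := fun ⟨⟨v, n, g⟩, h⟩ => by simp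
      right_inv := fun ⟨⟨v, n, g⟩, h⟩ => by
        obtain ⟨h₁, h₂⟩ := h
        simp only at h₁
        subst h₁
        refine Subtype.ext (Prod.ext rfl (Prod.ext ?_ (mul_inv_cancel_left _ _)))
        exact congrArg Subtype.val ((j e).apply_symm_apply ⟨n, h₂⟩) }

/-! ### The grading by translation degree. -/

section Translation

variable (R : Type w) [CommRing R] (Y Z : Type*) (Γ : Type*) [Group Γ]

/-- The operators on functions on `Y × Z × Γ` that translate the last coordinate by `g`. -/
def translationDegree (g : Γ) : Submodule R (Module.End R (Y × Z × Γ → R)) where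
  carrier := {T | ∀ (φ : Y × Z × Γ → R) (h : Γ), (∀ y z, φ (y, z, g⁻¹ * h) = 0) →
    ∀ y z, T φ (y, z, h) = 0}
  add_mem' hS hT φ h hφ y z := by
    rw [LinearMap.add_apply, Pi.add_apply, hS φ h hφ y z, hT φ h hφ y z, add_zero]
  zero_mem' _ _ _ _ _ := rfl
  smul_mem' c T hT φ h hφ y z := by
    rw [LinearMap.smul_apply, Pi.smul_apply, hT φ h hφ y z, smul_zero]

variable {R Y Z Γ}

theorem mul_mem_translationDegree {g h : Γ} {S T : Module.End R (Y × Z × Γ → R)}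
    (hS : S ∈ translationDegree R Y Z Γ g) (hT : T ∈ translationDegree R Y Z Γ h) :
    S * T ∈ translationDegree R Y Z Γ (g * h) := fun φ k hφ y z =>
  hS (T φ) k (fun y z => hT φ _ (fun y z => by rw [← mul_assoc, ← mul_inv_rev]; exact hφ y z) y z)
    y z

/-- At height `h`, an operator of degree `g` sees only the layer of `φ` at height `g⁻¹h`. Cutting
`φ` down to that layer preserves the degree `g` term and kills all others there. -/
theorem iSupIndep_translationDegree : iSupIndep (translationDegree R Y Z Γ) := by
  classical
  refine (iSupIndep_iff_finsetSum_eq_zero_imp_eq_zero _).2 fun F T hT hsum g hg => ?_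
  refine LinearMap.ext fun φ => funext fun ⟨y, z, h⟩ => ?_
  let ψ : Y × Z × Γ → R := fun x => if x.2.2 = g⁻¹ * h then φ x else 0
  have h₁ : T g φ (y, z, h) = T g ψ (y, z, h) := by
    rw [← sub_eq_zero, ← Pi.sub_apply, ← map_sub]
    exact hT g hg _ h (fun y z => by simp [ψ]) y z
  have h₂ : ∑ k ∈ F, T k ψ (y, z, h) = T g ψ (y, z, h) := by
    refine Finset.sum_eq_single g (fun k hk hkg => ?_) fun h => (h hg).elim
    refine hT k hk ψ h (fun y z => if_neg fun heq => hkg ?_) y z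
    exact inv_injective (mul_right_cancel heq)
  rw [h₁, ← h₂, ← Finset.sum_apply, ← LinearMap.sum_apply, hsum]
  rfl

end Translation

/-! ### Faithfulness of the induced representation. -/

theorem isCompatibleGrading_freeBranchingSystem (G : Ultragraph V E) (P : G.EdgePartition)
    (j : ∀ e, G.r e × ℕ ≃ P.part e) (R : Type w) [CommRing R] :
    LeavittPathAlgebra.IsCompatibleGrading ((G.freeBranchingSystem P j).inducedRep R)
      (translationDegree R V ℕ (FreeGroup E)) where
  indep := iSupIndep_translationDegree
  mul_mem := mul_mem_translationDegree
  map_s e := by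
    classical
    intro φ h hφ y z
    rw [BranchingSystem.inducedRep_s]
    refine dite_eq_right_iff.2 fun hx => ?_
    -- `f_e⁻¹` carries height `h` to `e⁻¹h`, exactly the layer on which `φ` is assumed to vanish.
    exact hφ _ _
  map_sStar e := by
    classical
    intro φ h hφ y z
    rw [BranchingSystem.inducedRep_sStar]
    refine dite_eq_right_iff.2 fun hx => ?_
    rw [inv_inv] at hφ
    exact hφ _ _
  map_p B := by
    classical
    intro φ h hφ y z
    rw [BranchingSystem.inducedRep_p]
    refine ite_eq_right_iff.2 fun hx => ?_
    simpa using hφ y z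

theorem inducedRep_freeBranchingSystem_injective (G : Ultragraph V E) (P : G.EdgePartition)
    (j : ∀ e, G.r e × ℕ ≃ P.part e) (R : Type w) [CommRing R] :
    Function.Injective ((G.freeBranchingSystem P j).inducedRep R) := by
  refine (G.isCompatibleGrading_freeBranchingSystem P j R).injective fun v c hc => ?_
  rw [map_smul, BranchingSystem.inducedRep_p] at hc
  -- Applied to the constant function `1`, the operator `c P_v` takes the value `c` at a point over
  -- `v`.
  have h₁ := congrFun (LinearMap.congr_fun hc fun _ => 1) (v, 0, 1)
  have hv : (v, 0, 1) ∈ (G.freeBranchingSystem P j).D (G.vert v) := rfl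
  simpa [BranchingSystem.opP, hv] using h₁

end Ultragraph

theorem mainTheorem6 {V : Type u} {E : Type v} (G : Ultragraph V E)
    (hs : ∀ w : V, (G.out w).Countable) (hr : ∀ e : E, (G.r e).Countable) :
    ∃ (X : Type (max u v)) (B : G.BranchingSystem X),
      ∀ (R : Type w) [CommRing R], Function.Injective (B.inducedRep R) := by
  obtain ⟨P⟩ := G.exists_edgePartition hs
  let j (e : E) : G.r e × ℕ ≃ P.part e := (P.exists_equiv hr e).some
  exact ⟨V × ℕ × FreeGroup E, G.freeBranchingSystem P j,
    fun R _ => G.inducedRep_freeBranchingSystem_injective P j R⟩
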